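/- Let $(R,\mathfrak m,k)$ be a commutative Noetherian local ring, and for a finitely generated $R$-module $M$ let $F_1\xrightarrow{f}F_0\to M\to 0$ be a minimal free presentation. Write $\Omega M=\ker(F_0\to M)$ for the first syzygy module, $\Omega^0M=M$ and $\Omega^{n+1}M=\Omega(\Omega^nM)$, $\operatorname{Tr}M=\operatorname{coker}\bigl(f^*\colon F_0^*\to F_1^*\bigr)$ for the transpose, where $(-)^*=\operatorname{Hom}_R(-,R)$, and $\lambda M=\Omega\operatorname{Tr}M$; these modules are determined up to isomorphism. Let $\operatorname{pd}$ denote projective dimension over $R$, and let $\operatorname{depth}R$ be the supremum of the lengths of the regular sequences in $\mathfrak m$. Let $L$ be an $R$-module of finite length, let $n\ge 0$ be an integer, and assume that $\lambda\Omega^nL\cong X\oplus Y$ for some $R$-modules $X$ and $Y$ with $X\neq 0$. Then the following statements are equivalent: (i) $\operatorname{pd}(X)<\infty$; (ii) $\operatorname{pd}(X)=n$; (iii) $\operatorname{depth}R>n$. -/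

import Mathlib

universe u

open CategoryTheory

noncomputable section

namespace HorizontalLinkage

/-- `p : R ^ b → M` is a minimal free cover of `M` over the local ring `R`: it is surjective and
its kernel lies in `𝔪 R ^ b`. -/
structure IsMinimalCover {R : Type u} [CommRing R] [IsLocalRing R] {M : Type u}
    [AddCommGroup M] [Module R M] {b : ℕ} (p : (Fin b → R) →ₗ[R] M) : Prop where
  surjective : Function.Surjective p
  ker_le : LinearMap.ker p ≤
    IsLocalRing.maximalIdeal R • (⊤ : Submodule R (Fin b → R))

/-- Every finitely generated module over a local ring has a minimal free cover. -/
theorem exists_isMinimalCover (R : Type u) [CommRing R] [IsLocalRing R] (M : Type u)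
    [AddCommGroup M] [Module R M] [Module.Finite R M] :
    ∃ (b : ℕ) (p : (Fin b → R) →ₗ[R] M), IsMinimalCover p := by
  classical
  let m := IsLocalRing.maximalIdeal R
  let : Field (R ⧸ m) := Ideal.Quotient.field m
  let Q := M ⧸ (m • (⊤ : Submodule R M))
  have : Module.Finite (R ⧸ m) Q := Module.Finite.of_restrictScalars_finite R (R ⧸ m) Q
  let c := Module.finBasis (R ⧸ m) Q
  choose g hg using fun i => Submodule.Quotient.mk_surjective (m • (⊤ : Submodule R M)) (c i)
  have key : ∀ v : Fin (Module.finrank (R ⧸ m) Q) → R,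
      (Submodule.Quotient.mk (Fintype.linearCombination R g v) : Q) =
        ∑ i, (Ideal.Quotient.mk m (v i)) • c i := by
    intro v
    rw [Fintype.linearCombination_apply]
    change Submodule.mkQ (m • (⊤ : Submodule R M)) _ = _
    rw [map_sum]
    refine Finset.sum_congr rfl fun i _ => ?_
    rw [map_smul, Submodule.mkQ_apply, hg]
    rfl
  refine ⟨_, Fintype.linearCombination R g, ?_, ?_⟩
  · rw [← LinearMap.range_eq_top]
    refine eq_top_iff.2 (Submodule.le_of_le_smul_of_le_jacobson_bot (I := m)
      Module.Finite.fg_top (IsLocalRing.maximalIdeal_le_jacobson _) ?_)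
    intro x _
    choose v hv using fun i => Ideal.Quotient.mk_surjective
      (c.repr (Submodule.Quotient.mk x : Q) i)
    have h : (Submodule.Quotient.mk (Fintype.linearCombination R g v) : Q) =
        Submodule.Quotient.mk x := by
      rw [key]
      simp only [hv]
      exact c.sum_repr _
    rw [Eq.comm, Submodule.Quotient.eq] at h
    rw [← sub_add_cancel x (Fintype.linearCombination R g v), add_comm]
    exact Submodule.add_mem_sup (LinearMap.mem_range_self _ v) h
  · intro v hv
    have h := key v
    rw [LinearMap.mem_ker.1 hv, Submodule.Quotient.mk_zero] at h
    have h0 := Fintype.linearIndependent_iff.1 c.linearIndependent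
      (fun i => Ideal.Quotient.mk m (v i)) h.symm
    rw [pi_eq_sum_univ' v]
    refine Submodule.sum_mem _ fun i _ => Submodule.smul_mem_smul ?_ trivial
    exact Ideal.Quotient.eq_zero_iff_mem.1 (h0 i)

section Constructions

variable {R : Type u} [CommRing R] [IsLocalRing R]

/-- The rank of the minimal free cover of `M` (its zeroth Betti number). -/
def coverRank (M : FGModuleCat.{u} R) : ℕ :=
  (exists_isMinimalCover R M).choose

/-- A minimal free cover `R ^ b → M`; it is unique up to isomorphism. -/
def cover (M : FGModuleCat.{u} R) : (Fin (coverRank M) → R) →ₗ[R] M :=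
  (exists_isMinimalCover R M).choose_spec.choose

theorem cover_isMinimalCover (M : FGModuleCat.{u} R) : IsMinimalCover (cover M) :=
  (exists_isMinimalCover R M).choose_spec.choose_spec

variable [IsNoetherianRing R]

/-- The first syzygy module `Ω M`: the kernel of the minimal free cover. -/
def syzygy (M : FGModuleCat.{u} R) : FGModuleCat.{u} R :=
  FGModuleCat.of R (LinearMap.ker (cover M))

/-- The `n`-th syzygy module `Ω ^ n M` in a minimal free resolution of `M`, with `Ω ^ 0 M = M`. -/
def iterSyzygy (n : ℕ) (M : FGModuleCat.{u} R) : FGModuleCat.{u} R :=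
  syzygy^[n] M

/-- The map `F₁ → F₀` of the minimal free presentation `F₁ → F₀ → M → 0`. -/
def presentation (M : FGModuleCat.{u} R) :
    (Fin (coverRank (syzygy M)) → R) →ₗ[R] (Fin (coverRank M) → R) :=
  (LinearMap.ker (cover M)).subtype ∘ₗ cover (syzygy M)

/-- The Auslander transpose `Tr M`: the cokernel of the `R`-dual `F₀* → F₁*` of the map in the
minimal free presentation of `M`. -/
def transpose (M : FGModuleCat.{u} R) : FGModuleCat.{u} R :=
  FGModuleCat.of R (Module.Dual R (Fin (coverRank (syzygy M)) → R) ⧸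
    LinearMap.range (presentation M).dualMap)

/-- The horizontal linkage operator `λ M = Ω Tr M`. -/
def linkage (M : FGModuleCat.{u} R) : FGModuleCat.{u} R :=
  syzygy (transpose M)

end Constructions

/-- The depth of a Noetherian local ring: the supremum of the lengths of the regular sequences
contained in the maximal ideal. -/
def depth (R : Type u) [CommRing R] [IsLocalRing R] : ℕ∞ :=
  ⨆ rs : {rs : List R // RingTheory.Sequence.IsRegular R rs ∧
    ∀ r ∈ rs, r ∈ IsLocalRing.maximalIdeal R}, (rs.1.length : ℕ∞)

/-- The projective dimension of a module (with value `⊥` on the zero module). -/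
abbrev pd (R : Type u) [CommRing R] (X : Type u) [AddCommGroup X] [Module R X] : WithBot ℕ∞ :=
  projectiveDimension (ModuleCat.of R X)

end HorizontalLinkage

end

/-! Let `N_j` be the image of `F_j* → (Ω^(j+1) L)*`, where `F_j → Ω^j L` is the minimal cover. Then
`λ Ω^n L ≅ N_n` (`linkage_equiv_dualImage`), so `X` is a retract of `N_n`. With `E_j = Ext^1(Ω^j L,
R)`, everything is read off the sequences `0 → (Ω^j L)* → F_j* → N_j → 0` and `0 → N_j → (Ω^(j+1)
L)* → E_j → 0`.

If the depth exceeds `n`, then `Ext^i(L, R) = 0` for `i ≤ n`. The dualized resolution is then a free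
resolution of `N_n` of length `n`, and `pd X ≤ n`.

Smaller values of `pd X` are excluded by two facts. First, a nonzero projective quotient of `N_n`
would yield a minimal generator of `Ω^n L` invisible to all functionals, which is impossible if `n ≥
1` or if the depth is `0` (`not_projective_of_surjective`). Second, `Ext^p(N_n, R) = 0` whenever `1
≤ p < n` and `p < depth R` (`extVanishes_dualImage_iterSyzygy`), whereas a finite module of
projective dimension exactly `p` has `Ext^p(-, R) ≠ 0`.

Conversely, let `pd X = p` be finite and `t = depth R ≤ n`. The first fact gives `p ≥ 1`.
Auslander–Buchsbaum gives `p ≤ t`, and `p ≠ t` because `X` embeds in a free module. So `1 ≤ p < t ≤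
n`, contradicting the second fact. -/

namespace HorizontalLinkage

open Abelian IsLocalRing

/-! ### Vanishing of `Ext` along short exact sequences and retracts -/

section ExtVanishing

variable {R : Type u} [CommRing R]
variable {A B C X Y : Type u} [AddCommGroup A] [Module R A] [AddCommGroup B] [Module R B]
  [AddCommGroup C] [Module R C] [AddCommGroup X] [Module R X] [AddCommGroup Y] [Module R Y]

variable (R X Y) in
/-- The vanishing of `Ext ^ i (X, Y)`. -/
def ExtVanishes (i : ℕ) : Prop :=
  Subsingleton (Ext (ModuleCat.of R X) (ModuleCat.of R Y) i)

/-- The short complex of modules given by two linear maps that form an exact sequence. -/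
abbrev shortComplexOfExact (f : A →ₗ[R] B) (g : B →ₗ[R] C) (h : Function.Exact f g) :
    ShortComplex (ModuleCat.{u} R) :=
  ModuleCat.shortComplexOfCompEqZero f g h.linearMap_comp_eq_zero

theorem shortExact_of_exact {f : A →ₗ[R] B} {g : B →ₗ[R] C} (h : Function.Exact f g)
    (hf : Function.Injective f) (hg : Function.Surjective g) :
    (shortComplexOfExact f g h).ShortExact :=
  ModuleCat.shortComplex_shortExact _ h hf hg

theorem extVanishes_of_projective [Module.Projective R X] (i : ℕ) :
    ExtVanishes R X Y (i + 1) := by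
  have : Projective (ModuleCat.of R X) := (IsProjective.iff_projective _).1 inferInstance
  exact Ext.subsingleton_of_projective _ _ i

theorem extVanishes_zero_iff : ExtVanishes R X Y 0 ↔ Subsingleton (X →ₗ[R] Y) :=
  (Ext.addEquiv₀.trans ModuleCat.homAddEquiv).toEquiv.subsingleton_congr

theorem ExtVanishes.of_retract_right {i : ℕ} (h : ExtVanishes R X B i) (f : A →ₗ[R] B)
    (g : B →ₗ[R] A) (hgf : g ∘ₗ f = LinearMap.id) : ExtVanishes R X A i := by
  refine subsingleton_of_forall_eq 0 fun e => ?_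
  have h1 : e.comp (Ext.mk₀ (ModuleCat.ofHom f)) (add_zero i) = 0 := h.elim _ _
  have h2 : ModuleCat.ofHom f ≫ ModuleCat.ofHom g = 𝟙 (ModuleCat.of R A) := by
    rw [← ModuleCat.ofHom_comp, hgf]; rfl
  have h3 := congrArg (fun z => z.comp (Ext.mk₀ (ModuleCat.ofHom g)) (add_zero i)) h1
  simpa [h2] using h3

theorem ExtVanishes.of_retract_left {i : ℕ} (h : ExtVanishes R B Y i) (f : A →ₗ[R] B)
    (g : B →ₗ[R] A) (hgf : g ∘ₗ f = LinearMap.id) : ExtVanishes R A Y i := by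
  refine subsingleton_of_forall_eq 0 fun e => ?_
  have h1 : (Ext.mk₀ (ModuleCat.ofHom g)).comp e (zero_add i) = 0 := h.elim _ _
  have h2 : ModuleCat.ofHom f ≫ ModuleCat.ofHom g = 𝟙 (ModuleCat.of R A) := by
    rw [← ModuleCat.ofHom_comp, hgf]; rfl
  have h3 := congrArg (fun z => (Ext.mk₀ (ModuleCat.ofHom f)).comp z (zero_add i)) h1
  simpa [h2] using h3

section Sequences

variable {f : A →ₗ[R] B} {g : B →ₗ[R] C} (h : Function.Exact f g)
  (hf : Function.Injective f) (hg : Function.Surjective g)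

include hf hg h

theorem ExtVanishes.left₃ {i : ℕ} (hA : ExtVanishes R A Y i) (hB : ExtVanishes R B Y (i + 1)) :
    ExtVanishes R C Y (i + 1) := by
  refine subsingleton_of_forall_eq 0 fun e => ?_
  obtain ⟨x, rfl⟩ := Ext.contravariant_sequence_exact₃ (shortExact_of_exact h hf hg) _ e
    (hB.elim _ _) (add_comm 1 i)
  rw [hA.elim x 0, Ext.comp_zero]

theorem ExtVanishes.left₂ {i : ℕ} (hA : ExtVanishes R A Y i) (hC : ExtVanishes R C Y i) :
    ExtVanishes R B Y i := by
  refine subsingleton_of_forall_eq 0 fun e => ?_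
  obtain ⟨x, rfl⟩ := Ext.contravariant_sequence_exact₂ (shortExact_of_exact h hf hg) _ e
    (hA.elim _ _)
  rw [hC.elim x 0, Ext.comp_zero]

theorem ExtVanishes.left₁ {i : ℕ} (hB : ExtVanishes R B Y i) (hC : ExtVanishes R C Y (i + 1)) :
    ExtVanishes R A Y i := by
  refine subsingleton_of_forall_eq 0 fun e => ?_
  obtain ⟨x, rfl⟩ := Ext.contravariant_sequence_exact₁ (shortExact_of_exact h hf hg) _ e
    (add_comm 1 i) (hC.elim _ _)
  rw [hB.elim x 0, Ext.comp_zero]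

/-- As `Ext^1(B, Y) = 0`, each class in `Ext^1(C, Y)` is the connecting image of some `A → Y`, and
this image vanishes once the map extends to `B`. -/
theorem extVanishes_one_of_extends (hB : ExtVanishes R B Y 1)
    (hext : ∀ φ : A →ₗ[R] Y, ∃ ψ : B →ₗ[R] Y, ψ ∘ₗ f = φ) : ExtVanishes R C Y 1 := by
  refine subsingleton_of_forall_eq 0 fun e => ?_
  obtain ⟨x, rfl⟩ := Ext.contravariant_sequence_exact₃ (shortExact_of_exact h hf hg) _ e
    (hB.elim _ _) (add_zero 1)
  obtain ⟨φ, rfl⟩ := (Ext.mk₀_bijective _ _).2 x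
  obtain ⟨ψ, hψ⟩ := hext φ.hom
  have : φ = (shortComplexOfExact f g h).f ≫ ModuleCat.ofHom ψ := by
    ext1; exact hψ.symm
  rw [this, ← Ext.mk₀_comp_mk₀]
  exact (shortExact_of_exact h hf hg).extClass_comp_assoc _

theorem ExtVanishes.exists_extension (hC : ExtVanishes R C Y 1) (φ : A →ₗ[R] Y) :
    ∃ ψ : B →ₗ[R] Y, ψ ∘ₗ f = φ := by
  obtain ⟨x, hx⟩ := Ext.contravariant_sequence_exact₁ (shortExact_of_exact h hf hg)
    (ModuleCat.of R Y) (Ext.mk₀ (ModuleCat.ofHom φ)) (add_zero 1) (hC.elim _ _)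
  obtain ⟨ψ, rfl⟩ := (Ext.mk₀_bijective _ _).2 x
  rw [Ext.mk₀_comp_mk₀] at hx
  exact ⟨ψ.hom, congrArg ModuleCat.Hom.hom ((Ext.mk₀_bijective _ _).1 hx)⟩

theorem ExtVanishes.right₃ {i : ℕ} (hB : ExtVanishes R X B i) (hA : ExtVanishes R X A (i + 1)) :
    ExtVanishes R X C i := by
  refine subsingleton_of_forall_eq 0 fun e => ?_
  obtain ⟨x, rfl⟩ := Ext.covariant_sequence_exact₃ _ (shortExact_of_exact h hf hg) e rfl
    (hA.elim _ _)
  rw [hB.elim x 0, Ext.zero_comp]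

theorem ExtVanishes.right₁_of_comp_eq_zero {i : ℕ} (hC : ExtVanishes R X C i)
    (hz : ∀ e : Ext (ModuleCat.of R X) (ModuleCat.of R A) (i + 1),
      e.comp (Ext.mk₀ (ModuleCat.ofHom f)) (add_zero (i + 1)) = 0) :
    ExtVanishes R X A (i + 1) := by
  refine subsingleton_of_forall_eq 0 fun e => ?_
  obtain ⟨x, rfl⟩ := Ext.covariant_sequence_exact₁ _ (shortExact_of_exact h hf hg) e (hz e) rfl
  rw [hC.elim x 0, Ext.zero_comp]

end Sequences

theorem ext_eq_zero_of_proj {ι : Type} [Fintype ι] {i : ℕ}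
    (e : Ext (ModuleCat.of R X) (ModuleCat.of R (ι → Y)) i)
    (h : ∀ j, e.comp (Ext.mk₀ (ModuleCat.ofHom (LinearMap.proj j))) (add_zero i) = 0) :
    e = 0 := by
  classical
  have hid : 𝟙 (ModuleCat.of R (ι → Y)) = ∑ j, ModuleCat.ofHom (LinearMap.proj j) ≫
      ModuleCat.ofHom (LinearMap.single R (fun _ : ι => Y) j) := by
    ext x k
    simp [ModuleCat.hom_sum, Pi.single_apply]
  have hs : Ext.mk₀ (𝟙 (ModuleCat.of R (ι → Y))) = ∑ j,
      (Ext.mk₀ (ModuleCat.ofHom (LinearMap.proj j : (ι → Y) →ₗ[R] Y))).comp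
        (Ext.mk₀ (ModuleCat.ofHom (LinearMap.single R (fun _ : ι => Y) j))) (add_zero 0) := by
    rw [hid]
    simp only [Ext.mk₀_comp_mk₀]
    exact map_sum (Ext.addEquiv₀ (X := ModuleCat.of R (ι → Y))
      (Y := ModuleCat.of R (ι → Y))).symm _ _
  rw [← Ext.comp_mk₀_id e, hs, Ext.comp_sum]
  refine Finset.sum_eq_zero fun j _ => ?_
  rw [← Ext.comp_assoc_of_third_deg_zero, h j, Ext.zero_comp]

theorem ExtVanishes.pi {i : ℕ} (h : ExtVanishes R X Y i) (ι : Type) [Fintype ι] :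
    ExtVanishes R X (ι → Y) i :=
  subsingleton_of_forall_eq 0 fun e => ext_eq_zero_of_proj e fun _ => h.elim _ _

theorem smul_ext_eq_zero {r : R} (hr : ∀ x : X, r • x = 0) {i : ℕ}
    (e : Ext (ModuleCat.of R X) (ModuleCat.of R Y) i) : r • e = 0 := by
  have h0 : r • 𝟙 (ModuleCat.of R X) = 0 := by
    ext x; exact hr x
  rw [← Ext.mk₀_id_comp e, ← Ext.smul_comp, ← Ext.mk₀_smul, h0, Ext.mk₀_zero, Ext.zero_comp]

/-- Each component of `φ` is a combination of coordinate functionals with coefficients in `I`, and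
`I` kills `Ext(X, -)` because it kills `X`. Applied with `X` the residue field and `φ` the first map
of a minimal resolution. -/
theorem ext_comp_eq_zero_of_le {ι : Type} {κ : Type*} [Fintype ι] [Fintype κ] {I : Ideal R}
    (hI : ∀ r ∈ I, ∀ x : X, r • x = 0) (b : Module.Basis κ R A) (φ : A →ₗ[R] (ι → R))
    (hφ : ∀ a j, φ a j ∈ I) {i : ℕ} (e : Ext (ModuleCat.of R X) (ModuleCat.of R A) i) :
    e.comp (Ext.mk₀ (ModuleCat.ofHom φ)) (add_zero i) = 0 := by
  classical
  refine ext_eq_zero_of_proj _ fun j => ?_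
  rw [Ext.comp_assoc_of_third_deg_zero, Ext.mk₀_comp_mk₀]
  have hsum : ModuleCat.ofHom φ ≫ ModuleCat.ofHom (LinearMap.proj j) =
      ∑ k, φ (b k) j • ModuleCat.ofHom (b.coord k) := by
    ext x
    have := congrArg (fun z => φ z j) (b.sum_repr x)
    simp only [map_sum, map_smul, Finset.sum_apply, Pi.smul_apply, smul_eq_mul] at this
    simp [ModuleCat.hom_sum, ← this, mul_comm]
  have hs : Ext.mk₀ (ModuleCat.ofHom φ ≫ ModuleCat.ofHom (LinearMap.proj j)) =
      ∑ k, φ (b k) j • Ext.mk₀ (ModuleCat.ofHom (b.coord k)) := by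
    rw [hsum]
    simp only [← Ext.mk₀_smul]
    exact map_sum (Ext.addEquiv₀ (X := ModuleCat.of R A) (Y := ModuleCat.of R R)).symm _ _
  rw [hs, Ext.comp_sum]
  refine Finset.sum_eq_zero fun k _ => ?_
  rw [Ext.comp_smul]
  exact smul_ext_eq_zero (hI _ (hφ _ _)) _

/-- A finite module of projective dimension at most `p` with `Ext ^ p (X, R) = 0` has projective
dimension less than `p`. -/
theorem hasProjectiveDimensionLT_of_extVanishes [IsNoetherianRing R] [Module.Finite R X] {p : ℕ}
    (hp : HasProjectiveDimensionLT (ModuleCat.of R X) (p + 1)) (h : ExtVanishes R X R p) :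
    HasProjectiveDimensionLT (ModuleCat.of R X) p := by
  refine ModuleCat.hasProjectiveDimensionLT_of_forall_finite _ _ fun L hL => ?_
  -- `Ext^p(X, L)` sits between `Ext^p(X, R^b) = 0` and `Ext^(p+1)(X, ker f) = 0`.
  obtain ⟨b, f, hf⟩ := Module.Finite.exists_fin' R L
  have hex : Function.Exact (LinearMap.ker f).subtype f := LinearMap.exact_subtype_ker_map f
  exact (h.pi (Fin b)).right₃ hex (Submodule.injective_subtype _) hf
    (HasProjectiveDimensionLT.subsingleton _ (p + 1) (p + 1) le_rfl _)

end ExtVanishing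

/-! ### The Auslander–Buchsbaum inequality -/

section AuslanderBuchsbaum

variable {R : Type u} [CommRing R] [IsLocalRing R]

theorem apply_mem_maximalIdeal {F : Type u} [AddCommGroup F] [Module R F] (φ : F →ₗ[R] R)
    {x : F} (hx : x ∈ maximalIdeal R • (⊤ : Submodule R F)) : φ x ∈ maximalIdeal R := by
  refine Submodule.smul_induction_on hx (fun r hr y _ => ?_) fun y z hy hz => ?_
  · rw [map_smul, smul_eq_mul]
    exact Ideal.mul_mem_right _ _ hr
  · rw [map_add]
    exact add_mem hy hz

/-- The inequality in the Auslander–Buchsbaum formula, with the depth measured by the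
vanishing of `Ext`. -/
theorem not_extVanishes_of_projectiveDimension [IsNoetherianRing R] {t : ℕ}
    (hlt : ∀ i < t, ExtVanishes R (R ⧸ maximalIdeal R) R i)
    (ht : ¬ ExtVanishes R (R ⧸ maximalIdeal R) R t) (p : ℕ) :
    ∀ (X : Type u) [AddCommGroup X] [Module R X] [Module.Finite R X],
      HasProjectiveDimensionLT (ModuleCat.of R X) (p + 2) →
      ¬ HasProjectiveDimensionLT (ModuleCat.of R X) (p + 1) →
      p + 1 ≤ t ∧ ¬ ExtVanishes R (R ⧸ maximalIdeal R) X (t - (p + 1)) := by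
  induction p with
  | zero =>
    intro X _ _ _ h2 h1
    obtain ⟨b, π, hπ⟩ := exists_isMinimalCover R X
    have hex := LinearMap.exact_subtype_ker_map π
    have hin := Submodule.injective_subtype (LinearMap.ker π)
    have hse := shortExact_of_exact hex hin hπ.surjective
    have hF : Projective (ModuleCat.of R (Fin b → R)) :=
      (IsProjective.iff_projective _).1 inferInstance
    have hK := (hse.hasProjectiveDimensionLT_X₃_iff 0 hF).1 h2
    have : Module.Projective R (LinearMap.ker π) := (IsProjective.iff_projective _).2
      (projective_iff_hasProjectiveDimensionLT_one.2 hK)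
    have : Module.Free R (LinearMap.ker π) := Module.free_of_flat_of_isLocalRing
    let v := Module.Free.chooseBasis R (LinearMap.ker π)
    have hne : Nonempty (Module.Free.ChooseBasisIndex R (LinearMap.ker π)) := by
      by_contra hc
      rw [not_nonempty_iff] at hc
      have : Subsingleton (LinearMap.ker π) := v.repr.toEquiv.subsingleton
      exact h1 (hse.hasProjectiveDimensionLT_X₃ 0
        ((ModuleCat.isZero_of_subsingleton _).hasProjectiveDimensionLT_zero) inferInstance)
    obtain ⟨j⟩ := hne
    -- The kernel is free and nonzero, so it has `R` as a retract.
    have hKt : ¬ ExtVanishes R (R ⧸ maximalIdeal R) (LinearMap.ker π) t := fun h =>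
      ht (h.of_retract_right (LinearMap.toSpanSingleton R _ (v j)) (v.coord j) (by
        ext; simp))
    -- By minimality the matrix of `ker π → R^b` has entries in the maximal ideal, so it induces
    -- zero on `Ext(k, -)`.
    have hzero : ∀ i (e : Ext (ModuleCat.of R (R ⧸ maximalIdeal R))
        (ModuleCat.of R (LinearMap.ker π)) i),
        e.comp (Ext.mk₀ (ModuleCat.ofHom (LinearMap.ker π).subtype)) (add_zero i) = 0 := by
      intro i e
      refine ext_comp_eq_zero_of_le (I := maximalIdeal R) (fun r hr x => ?_) v _
        (fun a l => apply_mem_maximalIdeal (LinearMap.proj l) (hπ.ker_le a.2)) e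
      obtain ⟨y, rfl⟩ := Ideal.Quotient.mk_surjective x
      rw [← Ideal.Quotient.mk_eq_mk, ← Submodule.Quotient.mk_smul, Ideal.Quotient.mk_eq_mk,
        Ideal.Quotient.eq_zero_iff_mem, smul_eq_mul]
      exact Ideal.mul_mem_right _ _ hr
    cases t with
    | zero =>
      -- On `Hom(k, -)` the inclusion induces a map that is both injective and zero.
      refine absurd (subsingleton_of_forall_eq 0 fun e => ?_) hKt
      have : Mono (ModuleCat.ofHom (LinearMap.ker π).subtype) :=
        (ModuleCat.mono_iff_injective _).2 hin
      apply Ext.postcomp_mk₀_injective_of_mono _ (ModuleCat.ofHom (LinearMap.ker π).subtype)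
      rw [map_zero]
      exact hzero 0 e
    | succ t =>
      exact ⟨by omega, fun h => hKt (h.right₁_of_comp_eq_zero hex hin hπ.surjective
        (hzero (t + 1)))⟩
  | succ p ih =>
    intro X _ _ _ h2 h1
    obtain ⟨b, π, hπ⟩ := exists_isMinimalCover R X
    have hex := LinearMap.exact_subtype_ker_map π
    have hin := Submodule.injective_subtype (LinearMap.ker π)
    have hse := shortExact_of_exact hex hin hπ.surjective
    have hF : Projective (ModuleCat.of R (Fin b → R)) :=
      (IsProjective.iff_projective _).1 inferInstance
    obtain ⟨hpt, hK⟩ := ih (LinearMap.ker π) ((hse.hasProjectiveDimensionLT_X₃_iff (p + 1) hF).1 h2)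
      fun h => h1 ((hse.hasProjectiveDimensionLT_X₃_iff p hF).2 h)
    -- Equality would give `Hom(k, ker π) ≠ 0`, although `ker π` lies in a free module and `Hom(k,
    -- R) = 0` since `t > 0`.
    have hpt' : p + 1 ≠ t := by
      rintro rfl
      rw [Nat.sub_self, extVanishes_zero_iff] at hK
      have : Subsingleton ((R ⧸ maximalIdeal R) →ₗ[R] (Fin b → R)) :=
        extVanishes_zero_iff.1 ((hlt 0 (by omega)).pi (Fin b))
      refine hK (subsingleton_of_forall_eq 0 fun φ => LinearMap.ext fun x => hin ?_)
      exact LinearMap.congr_fun (Subsingleton.elim ((LinearMap.ker π).subtype ∘ₗ φ) 0) x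
    refine ⟨by omega, fun h => hK ?_⟩
    have hi : t - (p + 1) = t - (p + 1 + 1) + 1 := by omega
    rw [hi]
    exact h.right₁_of_comp_eq_zero hex hin hπ.surjective fun e =>
      ((hlt _ (by omega)).pi (Fin b)).elim _ _

end AuslanderBuchsbaum

/-! ### Dualizing a free cover -/

section DualSequences

variable {R : Type u} [CommRing R] {F M : Type u} [AddCommGroup F] [Module R F]
  [AddCommGroup M] [Module R M]

/-- The image of `F* → (ker π)*` for a linear map `π : F → M`. -/
abbrev dualImage (π : F →ₗ[R] M) : Submodule R (Module.Dual R (LinearMap.ker π)) :=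
  LinearMap.range (LinearMap.ker π).subtype.dualMap

/-- The cokernel of `F* → (ker π)*`, which is `Ext ^ 1 (M, R)` for `π` a free cover of `M`. -/
abbrev dualCoker (π : F →ₗ[R] M) : Type u :=
  Module.Dual R (LinearMap.ker π) ⧸ dualImage π

theorem exact_dualMap_rangeRestrict {π : F →ₗ[R] M} (hπ : Function.Surjective π) :
    Function.Exact π.dualMap (LinearMap.ker π).subtype.dualMap.rangeRestrict := by
  rw [LinearMap.exact_iff, LinearMap.ker_rangeRestrict,
    LinearMap.range_dualMap_eq_dualAnnihilator_ker_of_surjective _ hπ,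
    LinearMap.ker_dualMap_eq_dualAnnihilator_range, Submodule.range_subtype]

theorem exact_dualImage (π : F →ₗ[R] M) :
    Function.Exact (dualImage π).subtype (dualImage π).mkQ :=
  LinearMap.exact_subtype_mkQ _

theorem shortExact_dualMap {π : F →ₗ[R] M} (hπ : Function.Surjective π) :
    (shortComplexOfExact (A := Module.Dual R M) (B := Module.Dual R F) (C := dualImage π) _ _
      (exact_dualMap_rangeRestrict hπ)).ShortExact :=
  shortExact_of_exact _ (LinearMap.dualMap_injective_of_surjective hπ)
    (LinearMap.surjective_rangeRestrict _)

theorem shortExact_dualImage (π : F →ₗ[R] M) :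
    (shortComplexOfExact (A := dualImage π) (B := Module.Dual R (LinearMap.ker π))
      (C := dualCoker π) _ _ (exact_dualImage π)).ShortExact :=
  shortExact_of_exact _ (Submodule.injective_subtype _) (Submodule.mkQ_surjective _)

theorem ExtVanishes.dual_ker {π : F →ₗ[R] M} {p : ℕ} (hE : ExtVanishes R (dualCoker π) R p)
    (hN : ExtVanishes R (dualImage π) R p) :
    ExtVanishes R (Module.Dual R (LinearMap.ker π)) R p :=
  hN.left₂ (exact_dualImage π) (Submodule.injective_subtype _) (Submodule.mkQ_surjective _) hE

theorem ExtVanishes.dualImage [Module.Finite R F] [Module.Projective R F] {π : F →ₗ[R] M}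
    (hπ : Function.Surjective π) {p : ℕ} (hM : ExtVanishes R (Module.Dual R M) R p) :
    ExtVanishes R (dualImage π) R (p + 1) :=
  hM.left₃ (exact_dualMap_rangeRestrict hπ) (LinearMap.dualMap_injective_of_surjective hπ)
    (LinearMap.surjective_rangeRestrict _) (extVanishes_of_projective p)

theorem ExtVanishes.ker [Module.Projective R F] {π : F →ₗ[R] M} (hπ : Function.Surjective π)
    {Y : Type u} [AddCommGroup Y] [Module R Y] {i : ℕ} (hM : ExtVanishes R M Y (i + 2)) :
    ExtVanishes R (LinearMap.ker π) Y (i + 1) :=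
  (extVanishes_of_projective i).left₁ (LinearMap.exact_subtype_ker_map π)
    (Submodule.injective_subtype _) hπ hM

theorem subsingleton_dualCoker {F M : Type u} [AddCommGroup F] [Module R F] [AddCommGroup M]
    [Module R M] {π : F →ₗ[R] M} (hπ : Function.Surjective π) (hM : ExtVanishes R M R 1) :
    Subsingleton (dualCoker π) := by
  rw [Submodule.Quotient.subsingleton_iff, LinearMap.range_eq_top]
  exact fun φ => hM.exists_extension (LinearMap.exact_subtype_ker_map π)
    (Submodule.injective_subtype _) hπ φ

theorem hasProjectiveDimensionLT_dualImage {F M : Type u} [AddCommGroup F] [Module R F]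
    [Module.Finite R F] [Module.Projective R F] [AddCommGroup M] [Module R M] {π : F →ₗ[R] M}
    (hπ : Function.Surjective π) {n : ℕ}
    (hM : HasProjectiveDimensionLT (ModuleCat.of R (Module.Dual R M)) n) :
    HasProjectiveDimensionLT (ModuleCat.of R (dualImage π)) (n + 1) := by
  have : Projective (ModuleCat.of R (Module.Dual R F)) :=
    (IsProjective.iff_projective _).1 inferInstance
  have h1 : HasProjectiveDimensionLT (ModuleCat.of R (Module.Dual R F)) 1 := inferInstance
  exact (shortExact_dualMap hπ).hasProjectiveDimensionLT_X₃ n hM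
    (hasProjectiveDimensionLT_of_ge _ 1 (n + 1) (by omega))

variable (R M) in
/-- A module is torsionless if its elements are separated by linear functionals. -/
def IsTorsionless : Prop := ∀ x : M, (∀ f : Module.Dual R M, f x = 0) → x = 0

theorem isTorsionless_ker_pi {b : ℕ} (π : (Fin b → R) →ₗ[R] M) :
    IsTorsionless R (LinearMap.ker π) := fun _ hx =>
  Subtype.ext (funext fun j => hx (LinearMap.proj j ∘ₗ (LinearMap.ker π).subtype))

/-- Functionals on the dual of a syzygy of a torsionless module extend along the dual of a cover,
up to functionals on `dualCoker`. -/
theorem extVanishes_one_dualImage [Module.Finite R F] [Module.Projective R F] {π : F →ₗ[R] M}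
    (hM : IsTorsionless R M) (hE : ExtVanishes R (dualCoker π) R 0) {F' : Type u}
    [AddCommGroup F'] [Module R F'] [Module.Finite R F'] [Module.Projective R F']
    {π' : F' →ₗ[R] LinearMap.ker π} (hπ' : Function.Surjective π') :
    ExtVanishes R (HorizontalLinkage.dualImage π') R 1 := by
  refine extVanishes_one_of_extends (exact_dualMap_rangeRestrict hπ')
    (LinearMap.dualMap_injective_of_surjective hπ') (LinearMap.surjective_rangeRestrict _)
    (extVanishes_of_projective 0) fun ψ => ?_
  -- Reflexivity of `F` makes `ψ`, restricted along `F* → (ker π)*`, evaluation at a point `x`.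
  let x : F := (Module.evalEquiv R F).symm (ψ ∘ₗ (LinearMap.ker π).subtype.dualMap)
  have hx : ∀ f : Module.Dual R F, f x = ψ ((LinearMap.ker π).subtype.dualMap f) := fun f =>
    Module.apply_evalEquiv_symm_apply R F f _
  -- Functionals of the form `f ∘ π` die on `ker π`, so every `f` vanishes at `π x`.
  have hxK : x ∈ LinearMap.ker π := by
    refine hM _ fun f => ?_
    have h0 : (LinearMap.ker π).subtype.dualMap (f ∘ₗ π) = 0 := by
      ext y
      simp
    have := hx (f ∘ₗ π)
    rwa [h0, map_zero] at this
  obtain ⟨y, hy⟩ := hπ' ⟨x, hxK⟩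
  refine ⟨Module.Dual.eval R F' y, ?_⟩
  have := extVanishes_zero_iff.1 hE
  -- The difference kills the image of `F*`, so it factors through `dualCoker π`, which has no
  -- nonzero functionals. Hence `ψ` is evaluation at `x`, and evaluation at a lift `y` extends it to
  -- `F'*`.
  let δ : Module.Dual R (LinearMap.ker π) →ₗ[R] R :=
    Module.Dual.eval R _ ⟨x, hxK⟩ - ψ
  have hδ : HorizontalLinkage.dualImage π ≤ LinearMap.ker δ := by
    rintro _ ⟨f, rfl⟩
    exact sub_eq_zero.2 (hx f)
  have h0 : (HorizontalLinkage.dualImage π).liftQ δ hδ = 0 := Subsingleton.elim _ _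
  ext f
  have h1 : δ f = 0 := LinearMap.congr_fun h0 (Submodule.Quotient.mk f)
  have h2 : f ⟨x, hxK⟩ - ψ f = 0 := h1
  simpa [hy, sub_eq_zero] using h2

/-- If multiplication by `a` on `M` factors through `π`, then `a` kills `dualCoker π`. -/
theorem smul_dualCoker_eq_zero {π : F →ₗ[R] M} {a : R} {σ : M →ₗ[R] F}
    (hσ : ∀ x, π (σ x) = a • x) (x : dualCoker π) : a • x = 0 := by
  obtain ⟨φ, rfl⟩ := Submodule.Quotient.mk_surjective _ x
  rw [← Submodule.Quotient.mk_smul, Submodule.Quotient.mk_eq_zero]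
  -- `a - σπ` lands in `ker π` and restricts to `a` there, so `φ ∘ ρ` extends `a • φ` to `F`.
  let ρ : F →ₗ[R] LinearMap.ker π :=
    (a • LinearMap.id - σ ∘ₗ π).codRestrict _ fun y => by simp [hσ]
  refine ⟨φ ∘ₗ ρ, LinearMap.ext fun y => ?_⟩
  have : ρ y = a • y := Subtype.ext (by simp [ρ])
  simp [this]

/-- If multiplication by `a` on `M` factors through `π`, then multiplication by `a` on `ker π`
factors through any cover of `ker π`. -/
theorem exists_factorization_ker [Module.Projective R F] {π : F →ₗ[R] M} {a : R}
    {σ : M →ₗ[R] F} (hσ : ∀ x, π (σ x) = a • x) {F' : Type u} [AddCommGroup F'] [Module R F']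
    {π' : F' →ₗ[R] LinearMap.ker π} (hπ' : Function.Surjective π') :
    ∃ σ' : LinearMap.ker π →ₗ[R] F', ∀ x, π' (σ' x) = a • x := by
  let ρ : F →ₗ[R] LinearMap.ker π :=
    (a • LinearMap.id - σ ∘ₗ π).codRestrict _ fun y => by simp [hσ]
  obtain ⟨τ, hτ⟩ := Module.projective_lifting_property π' ρ hπ'
  refine ⟨τ ∘ₗ (LinearMap.ker π).subtype, fun y => ?_⟩
  have : ρ y = a • y := Subtype.ext (by simp [ρ])
  simpa [this] using LinearMap.congr_fun hτ y

end DualSequences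

/-! ### Regular sequences, minimal covers and linkage over a local ring -/

section Local

variable {R : Type u} [CommRing R] [IsLocalRing R]

theorem IsFiniteLength.exists_pow_smul_eq_zero {L : Type u} [AddCommGroup L] [Module R L]
    (hL : IsFiniteLength R L) {a : R} (ha : a ∈ maximalIdeal R) :
    ∃ s : ℕ, ∀ x : L, a ^ s • x = 0 := by
  induction hL with
  | of_subsingleton => exact ⟨0, fun x => Subsingleton.elim _ _⟩
  | @of_simple_quotient M _ _ N hs _ ih =>
    obtain ⟨s, hs⟩ := ih
    refine ⟨s + 1, fun x => ?_⟩
    have hmax := eq_maximalIdeal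
      (IsSimpleModule.annihilator_isMaximal (R := R) (M := M ⧸ N))
    have hx := Module.mem_annihilator.1 (hmax.symm ▸ ha) (Submodule.Quotient.mk x : M ⧸ N)
    rw [← Submodule.Quotient.mk_smul, Submodule.Quotient.mk_eq_zero] at hx
    rw [pow_succ, mul_smul]
    exact congrArg Subtype.val (hs ⟨a • x, hx⟩)

theorem maximalIdeal_smul_lt_top : maximalIdeal R • (⊤ : Submodule R R) < ⊤ := by
  rw [smul_eq_mul, Ideal.mul_top]
  exact (maximalIdeal.isMaximal R).ne_top.lt_top

theorem extVanishes_of_pow_smul_eq_zero [IsNoetherianRing R] {E : Type u} [AddCommGroup E]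
    [Module R E] [Module.Finite R E]
    (hE : ∀ a ∈ maximalIdeal R, ∃ s : ℕ, ∀ x : E, a ^ s • x = 0) {rs : List R}
    (hrs : RingTheory.Sequence.IsRegular R rs) (hm : ∀ r ∈ rs, r ∈ maximalIdeal R) :
    ∀ i < rs.length, ExtVanishes R E R i := by
  refine ModuleCat.subsingleton_ext_of_exists_isRegular (maximalIdeal R) (ModuleCat.of R E) ?_
    (ModuleCat.of R R) maximalIdeal_smul_lt_top rs hm hrs
  rw [Module.support_eq_zeroLocus, PrimeSpectrum.zeroLocus_subset_zeroLocus_iff]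
  intro a ha
  obtain ⟨s, hs⟩ := hE a ha
  exact ⟨s, Module.mem_annihilator.2 hs⟩

theorem exists_isRegular_of_extVanishes [IsNoetherianRing R] {t : ℕ}
    (h : ∀ i < t, ExtVanishes R (R ⧸ maximalIdeal R) R i) :
    ∃ rs : List R, rs.length = t ∧ (∀ r ∈ rs, r ∈ maximalIdeal R) ∧
      RingTheory.Sequence.IsRegular R rs := by
  refine ModuleCat.exists_isRegular_of_exists_subsingleton_ext (maximalIdeal R) t
    (ModuleCat.of R R) maximalIdeal_smul_lt_top (ModuleCat.of R (R ⧸ maximalIdeal R)) ?_ h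
  rw [Module.support_eq_zeroLocus, Ideal.annihilator_quotient]

theorem lt_depth_iff {n : ℕ} : (n : ℕ∞) < depth R ↔ ∃ rs : List R,
    RingTheory.Sequence.IsRegular R rs ∧ (∀ r ∈ rs, r ∈ maximalIdeal R) ∧ n < rs.length := by
  rw [depth, lt_iSup_iff]
  constructor
  · rintro ⟨⟨rs, h1, h2⟩, h⟩
    exact ⟨rs, h1, h2, by exact_mod_cast h⟩
  · rintro ⟨rs, h1, h2, h⟩
    exact ⟨⟨rs, h1, h2⟩, by exact_mod_cast h⟩

theorem mem_maximalIdeal_smul_top {b : ℕ} {x : Fin b → R} (hx : ∀ j, x j ∈ maximalIdeal R) :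
    x ∈ maximalIdeal R • (⊤ : Submodule R (Fin b → R)) := by
  rw [pi_eq_sum_univ' x]
  exact Submodule.sum_mem _ fun j _ => Submodule.smul_mem_smul (hx j) trivial

theorem surjective_of_comp_surjective {F G T : Type u} [AddCommGroup F] [Module R F]
    [AddCommGroup G] [Module R G] [Module.Finite R G] [AddCommGroup T] [Module R T]
    {p : F →ₗ[R] T} {q : G →ₗ[R] T} (hp : Function.Surjective p)
    (hq : LinearMap.ker q ≤ maximalIdeal R • ⊤) {h : F →ₗ[R] G} (hh : q ∘ₗ h = p) :
    Function.Surjective h := by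
  rw [← LinearMap.range_eq_top]
  refine eq_top_iff.2 (Submodule.le_of_le_smul_of_le_jacobson_bot (I := maximalIdeal R)
    Module.Finite.fg_top (maximalIdeal_le_jacobson _) fun x _ => ?_)
  obtain ⟨y, hy⟩ := hp (q x)
  rw [← sub_add_cancel x (h y), add_comm]
  refine Submodule.add_mem_sup (LinearMap.mem_range_self _ y) (hq ?_)
  rw [LinearMap.mem_ker, map_sub, ← hy, ← hh, LinearMap.comp_apply, sub_self]

/-- Minimal projective covers have isomorphic kernels. -/
theorem nonempty_ker_linearEquiv {F G T : Type u} [AddCommGroup F] [Module R F]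
    [Module.Finite R F] [Module.Projective R F] [AddCommGroup G] [Module R G] [Module.Finite R G]
    [Module.Projective R G] [AddCommGroup T] [Module R T] {p : F →ₗ[R] T} {q : G →ₗ[R] T}
    (hp : Function.Surjective p) (hq : Function.Surjective q)
    (hp' : LinearMap.ker p ≤ maximalIdeal R • ⊤) (hq' : LinearMap.ker q ≤ maximalIdeal R • ⊤) :
    Nonempty (LinearMap.ker p ≃ₗ[R] LinearMap.ker q) := by
  obtain ⟨h, hh⟩ := Module.projective_lifting_property q p hq
  obtain ⟨g, hg⟩ := Module.projective_lifting_property p q hp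
  have hs := surjective_of_comp_surjective hp hq' hh
  have hgs := surjective_of_comp_surjective hq hp' hg
  -- `g ∘ h` is a surjective endomorphism of a finite module, hence injective.
  have hi : Function.Injective h := by
    have := OrzechProperty.injective_of_surjective_endomorphism (g ∘ₗ h)
      (by rw [LinearMap.coe_comp]; exact hgs.comp hs)
    rw [LinearMap.coe_comp] at this
    exact this.of_comp
  let e := LinearEquiv.ofBijective h ⟨hi, hs⟩
  have hk : LinearMap.ker p = (LinearMap.ker q).comap (e : F →ₗ[R] G) := by
    rw [← hh, LinearMap.ker_comp]; rfl
  exact ⟨(LinearEquiv.ofEq _ _ hk).trans (e.ofSubmodule' (LinearMap.ker q))⟩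

/-- A nonzero projective quotient of `dualImage π` gives a minimal generator that every
functional kills. -/
theorem exists_forall_dual_apply_eq_zero {M X : Type u} [AddCommGroup M] [Module R M]
    [AddCommGroup X] [Module R X] [Nontrivial X] [Module.Finite R X] [Module.Projective R X]
    {b : ℕ} {π : (Fin b → R) →ₗ[R] M} {g : dualImage π →ₗ[R] X} (hg : Function.Surjective g) :
    ∃ x : Fin b → R, x ∉ maximalIdeal R • (⊤ : Submodule R (Fin b → R)) ∧
      ∀ f : Module.Dual R M, f (π x) = 0 := by
  have : Module.Free R X := Module.free_of_flat_of_isLocalRing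
  let v := Module.Free.chooseBasis R X
  have hne : Nonempty (Module.Free.ChooseBasisIndex R X) := v.index_nonempty
  obtain ⟨j⟩ := hne
  -- A coordinate of `X`, pulled back to `F*`, is evaluation at the desired point of `F = R^b`. It
  -- takes the value `1`, so the point is outside `𝔪F`; it kills the image of `M*`, so no functional
  -- on `M` sees it.
  let G : Module.Dual R (Module.Dual R (Fin b → R)) :=
    v.coord j ∘ₗ g ∘ₗ (LinearMap.ker π).subtype.dualMap.rangeRestrict
  have hG : ∀ f : Module.Dual R (Fin b → R), f ((Module.evalEquiv R (Fin b → R)).symm G) = G f :=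
    fun f => Module.apply_evalEquiv_symm_apply R (Fin b → R) f _
  refine ⟨(Module.evalEquiv R (Fin b → R)).symm G, fun hx => ?_, fun f => ?_⟩
  · obtain ⟨y, hy⟩ := hg (v j)
    obtain ⟨f, rfl⟩ := LinearMap.surjective_rangeRestrict _ y
    have h1 := apply_mem_maximalIdeal f hx
    have h2 : G f = 1 := by simp [G, hy]
    rw [hG, h2] at h1
    exact (maximalIdeal.isMaximal R).ne_top ((Ideal.eq_top_iff_one _).2 h1)
  · refine (hG (f ∘ₗ π)).trans ?_
    have : (LinearMap.ker π).subtype.dualMap.rangeRestrict (f ∘ₗ π) = 0 := by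
      ext y
      simp
    simp [G, this]

/-- In depth `0` there is a nonzero socle element `r`. If `x j` is a unit, `r` times the `j`-th
coordinate kills `𝔪F`, hence `ker π`, and descends to a functional on `M` that is nonzero at `π x`.
-/
theorem exists_dual_apply_ne_zero {M : Type u} [AddCommGroup M] [Module R M] {b : ℕ}
    {π : (Fin b → R) →ₗ[R] M} (hπ : IsMinimalCover π)
    (hR : ¬ ExtVanishes R (R ⧸ maximalIdeal R) R 0) {x : Fin b → R}
    (hx : x ∉ maximalIdeal R • (⊤ : Submodule R (Fin b → R))) :
    ∃ f : Module.Dual R M, f (π x) ≠ 0 := by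
  rw [extVanishes_zero_iff, not_subsingleton_iff_nontrivial] at hR
  obtain ⟨φ, hφ⟩ := exists_ne (0 : (R ⧸ maximalIdeal R) →ₗ[R] R)
  have hmk : ∀ a : R, φ (Ideal.Quotient.mk _ a) = a * φ 1 := fun a => by
    rw [← smul_eq_mul, ← map_smul]
    congr 1
    rw [Algebra.smul_def, mul_one]; rfl
  have hr : φ 1 ≠ 0 := fun h => hφ (LinearMap.ext fun y => by
    obtain ⟨a, rfl⟩ := Ideal.Quotient.mk_surjective y
    rw [hmk, h, mul_zero]; rfl)
  have hkill : ∀ a ∈ maximalIdeal R, a * φ 1 = 0 := fun a ha => by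
    rw [← hmk, Ideal.Quotient.eq_zero_iff_mem.2 ha, map_zero]
  obtain ⟨j, hj⟩ : ∃ j, x j ∉ maximalIdeal R := by
    by_contra! h
    exact hx (mem_maximalIdeal_smul_top h)
  let h0 : (Fin b → R) →ₗ[R] R := φ 1 • LinearMap.proj j
  have hle : LinearMap.ker π ≤ LinearMap.ker h0 := fun y hy => by
    have := hkill _ (apply_mem_maximalIdeal (LinearMap.proj j) (hπ.ker_le hy))
    rw [LinearMap.mem_ker, LinearMap.smul_apply, smul_eq_mul, mul_comm]
    exact this
  refine ⟨(LinearMap.ker π).liftQ h0 hle ∘ₗ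
    (π.quotKerEquivOfSurjective hπ.surjective).symm.toLinearMap, fun h => ?_⟩
  have h1 : (π.quotKerEquivOfSurjective hπ.surjective).symm (π x) = Submodule.Quotient.mk x := by
    rw [LinearEquiv.symm_apply_eq]; rfl
  rw [LinearMap.comp_apply, LinearEquiv.coe_coe, h1, Submodule.liftQ_apply] at h
  have hu : IsUnit (x j) := by simpa using hj
  exact hr ((hu.mul_left_eq_zero).1 h)

variable [IsNoetherianRing R]

/-- Transposing the presentation matrix keeps its entries in the maximal ideal, so `F₁* → Tr M` is a
minimal cover and `λ M` is the image of `F₀* → F₁*`. This map factors through the injection `(Ω M)*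
→ F₁*`. -/
theorem linkage_equiv_dualImage (M : FGModuleCat.{u} R) :
    Nonempty (linkage M ≃ₗ[R] dualImage (cover M)) := by
  let q := (LinearMap.range (presentation M).dualMap).mkQ
  have hker : LinearMap.ker q = LinearMap.range (presentation M).dualMap := Submodule.ker_mkQ _
  have hq : LinearMap.ker q ≤ maximalIdeal R • ⊤ := by
    rw [hker]
    rintro _ ⟨φ, rfl⟩
    let b := (Pi.basisFun R (Fin (coverRank (syzygy M)))).dualBasis
    rw [← b.sum_repr ((presentation M).dualMap φ)]
    refine Submodule.sum_mem _ fun j _ => Submodule.smul_mem_smul ?_ trivial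
    have : b.repr ((presentation M).dualMap φ) j =
        φ (presentation M (Pi.basisFun R (Fin (coverRank (syzygy M))) j)) := by
      simp [b]
    rw [this]
    exact apply_mem_maximalIdeal φ ((cover_isMinimalCover M).ker_le
      (cover (syzygy M) (Pi.basisFun R _ j)).2)
  obtain ⟨e⟩ := nonempty_ker_linearEquiv (cover_isMinimalCover (transpose M)).surjective
    (Submodule.mkQ_surjective _) (cover_isMinimalCover (transpose M)).ker_le hq
  let c : (Fin (coverRank (syzygy M)) → R) →ₗ[R] LinearMap.ker (cover M) := cover (syzygy M)
  have hinj : Function.Injective c.dualMap :=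
    LinearMap.dualMap_injective_of_surjective (cover_isMinimalCover (syzygy M)).surjective
  have hr : LinearMap.range (presentation M).dualMap = (dualImage (cover M)).map c.dualMap :=
    LinearMap.range_comp (LinearMap.ker (cover M)).subtype.dualMap c.dualMap
  exact ⟨e.trans ((LinearEquiv.ofEq _ _ (hker.trans hr)).trans
    (Submodule.equivMapOfInjective _ hinj _).symm)⟩

end Local

/-! ### Syzygies of a module of finite length -/

section Syzygies

variable {R : Type u} [CommRing R] [IsLocalRing R] [IsNoetherianRing R] (L : FGModuleCat.{u} R)

theorem iterSyzygy_succ (n : ℕ) : iterSyzygy (n + 1) L = syzygy (iterSyzygy n L) :=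
  Function.iterate_succ_apply' _ _ _

theorem isTorsionless_iterSyzygy_succ (n : ℕ) : IsTorsionless R (iterSyzygy (n + 1) L) := by
  rw [iterSyzygy_succ]
  exact isTorsionless_ker_pi (cover (iterSyzygy n L))

variable {L}

theorem exists_factorization_iterSyzygy {a : R} (ha : ∀ x : L, a • x = 0) (n : ℕ) :
    ∃ σ : iterSyzygy n L →ₗ[R] (Fin (coverRank (iterSyzygy n L)) → R),
      ∀ x, cover (iterSyzygy n L) (σ x) = a • x := by
  induction n with
  | zero => exact ⟨0, fun x => by rw [LinearMap.zero_apply, map_zero]; exact (ha x).symm⟩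
  | succ n ih =>
    rw [iterSyzygy_succ]
    obtain ⟨σ, hσ⟩ := ih
    exact exists_factorization_ker hσ (cover_isMinimalCover (syzygy (iterSyzygy n L))).surjective

/-- A power of `a` kills `L`, so multiplication by it on `L` factors through zero, and on each
syzygy through the free cover. It therefore kills `Ext^1(Ω^n L, R)`. -/
theorem extVanishes_dualCoker_iterSyzygy
    (hL : ∀ a ∈ maximalIdeal R, ∃ s : ℕ, ∀ x : L, a ^ s • x = 0) {rs : List R}
    (hrs : RingTheory.Sequence.IsRegular R rs) (hm : ∀ r ∈ rs, r ∈ maximalIdeal R) (n : ℕ) :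
    ∀ i < rs.length, ExtVanishes R (dualCoker (cover (iterSyzygy n L))) R i := by
  refine extVanishes_of_pow_smul_eq_zero (fun a ha => ?_) hrs hm
  obtain ⟨s, hs⟩ := hL a ha
  obtain ⟨σ, hσ⟩ := exists_factorization_iterSyzygy hs n
  exact ⟨s, smul_dualCoker_eq_zero hσ⟩

/-- The two dual sequences shift `Ext^(p+1)(N_m, R) = 0` to `Ext^(p+2)(N_(m+1), R) = 0`. The
induction starts at `Ext^1`, which needs two syzygy steps: the cover of `Ω(Ω^(m+1) L)` with `Ω^(m+1)
L` torsionless. -/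
theorem extVanishes_dualImage_iterSyzygy {t : ℕ}
    (hE : ∀ n, ∀ i < t, ExtVanishes R (dualCoker (cover (iterSyzygy n L))) R i) (p : ℕ) :
    ∀ n, p + 2 ≤ n → p + 2 ≤ t →
      ExtVanishes R (dualImage (cover (iterSyzygy n L))) R (p + 1) := by
  induction p with
  | zero =>
    intro n hn ht
    obtain ⟨m, rfl⟩ := Nat.exists_eq_add_of_le' hn
    rw [zero_add, iterSyzygy_succ L (m + 1)]
    exact extVanishes_one_dualImage (isTorsionless_iterSyzygy_succ L m) (hE (m + 1) 0 (by omega))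
      (cover_isMinimalCover (syzygy (iterSyzygy (m + 1) L))).surjective
  | succ p ih =>
    intro n hn ht
    obtain ⟨m, rfl⟩ := Nat.exists_eq_add_of_le' (show 1 ≤ n by omega)
    rw [iterSyzygy_succ L m]
    exact ((hE m (p + 1) (by omega)).dual_ker (ih m (by omega) (by omega))).dualImage
      (cover_isMinimalCover (syzygy (iterSyzygy m L))).surjective

theorem extVanishes_iterSyzygy {n : ℕ} (hL : ∀ i ≤ n, ExtVanishes R L R i) (j : ℕ) :
    ∀ i, i + 1 + j ≤ n → ExtVanishes R (iterSyzygy j L) R (i + 1) := by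
  induction j with
  | zero => exact fun i hi => hL _ hi
  | succ j ih =>
    intro i hi
    rw [iterSyzygy_succ]
    exact (ih (i + 1) (by omega)).ker (cover_isMinimalCover (iterSyzygy j L)).surjective

/-- `L* = 0` makes `N_0` free, and `Ext^1(Ω^j L, R) = 0` identifies `N_j` with `(Ω^(j+1) L)*`, so
each step adds at most one to the projective dimension. -/
theorem hasProjectiveDimensionLT_dualImage_iterSyzygy {n : ℕ}
    (hL : ∀ i ≤ n, ExtVanishes R L R i) (j : ℕ) : j ≤ n →
      HasProjectiveDimensionLT (ModuleCat.of R (dualImage (cover (iterSyzygy j L)))) (j + 1) := by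
  induction j with
  | zero =>
    intro _
    have : Subsingleton (Module.Dual R L) := extVanishes_zero_iff.1 (hL 0 (Nat.zero_le n))
    exact hasProjectiveDimensionLT_dualImage (cover_isMinimalCover L).surjective
      (ModuleCat.isZero_of_subsingleton _).hasProjectiveDimensionLT_zero
  | succ j ih =>
    intro hj
    rw [iterSyzygy_succ L j]
    refine hasProjectiveDimensionLT_dualImage
      (cover_isMinimalCover (syzygy (iterSyzygy j L))).surjective ?_
    have : Subsingleton (dualCoker (cover (iterSyzygy j L))) :=
      subsingleton_dualCoker (cover_isMinimalCover (iterSyzygy j L)).surjective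
        (extVanishes_iterSyzygy hL j 0 (by omega))
    have h0 := (ModuleCat.isZero_of_subsingleton
      (ModuleCat.of R (dualCoker (cover (iterSyzygy j L))))).hasProjectiveDimensionLT_zero
    exact (shortExact_dualImage (cover (iterSyzygy j L))).hasProjectiveDimensionLT_X₂ (j + 1)
      (ih (by omega)) (hasProjectiveDimensionLT_of_ge _ 0 (j + 1) (by omega))

/-- The minimal generator killed by all functionals contradicts torsionlessness when `n ≥ 1`, and
the socle functional in depth `0`. For `n = 0` in positive depth with `L` of finite length, `L* = 0`
and `N_0` is free, so that case must be left out. -/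
theorem not_projective_of_surjective {n : ℕ} {X : Type u} [AddCommGroup X] [Module R X]
    [Nontrivial X] [Module.Finite R X] {g : dualImage (cover (iterSyzygy n L)) →ₗ[R] X}
    (hg : Function.Surjective g)
    (hn : 1 ≤ n ∨ ¬ ExtVanishes R (R ⧸ maximalIdeal R) R 0) : ¬ Module.Projective R X := by
  intro hX
  obtain ⟨x, hx, hf⟩ := exists_forall_dual_apply_eq_zero hg
  rcases hn with hn | hR
  · obtain ⟨m, rfl⟩ := Nat.exists_eq_add_of_le' hn
    exact hx ((cover_isMinimalCover _).ker_le (isTorsionless_iterSyzygy_succ L m _ hf))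
  · obtain ⟨f, hne⟩ := exists_dual_apply_ne_zero (cover_isMinimalCover _) hR hx
    exact hne (hf f)

end Syzygies

theorem exists_hasProjectiveDimensionLT_succ {R : Type u} [CommRing R] {X : Type u}
    [AddCommGroup X] [Module R X] [Nontrivial X] {m : ℕ}
    (h : HasProjectiveDimensionLT (ModuleCat.of R X) m) :
    ∃ p < m, HasProjectiveDimensionLT (ModuleCat.of R X) (p + 1) ∧
      ¬ HasProjectiveDimensionLT (ModuleCat.of R X) p := by
  induction m with
  | zero =>
    have := ModuleCat.subsingleton_of_isZero (isZero_of_hasProjectiveDimensionLT_zero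
      (ModuleCat.of R X))
    exact (not_subsingleton X this).elim
  | succ m ih =>
    by_cases hm : HasProjectiveDimensionLT (ModuleCat.of R X) m
    · obtain ⟨p, hp, hX⟩ := ih hm
      exact ⟨p, by omega, hX⟩
    · exact ⟨m, by omega, h, hm⟩

end HorizontalLinkage

/-! ### The equivalence of the three conditions -/

open HorizontalLinkage IsLocalRing in
theorem corollary5p4 (R : Type u) [CommRing R] [IsLocalRing R] [IsNoetherianRing R]
    (L : Type u) [AddCommGroup L] [Module R L] [Module.Finite R L] (hL : IsFiniteLength R L)
    (n : ℕ)
    (X Y : Type u) [AddCommGroup X] [Module R X] [Nontrivial X] [AddCommGroup Y] [Module R Y]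
    (hXY : Nonempty
      (HorizontalLinkage.linkage (HorizontalLinkage.iterSyzygy n (FGModuleCat.of R L)) ≃ₗ[R]
        X × Y)) :
    List.TFAE [
      HorizontalLinkage.pd R X < ⊤,
      HorizontalLinkage.pd R X = n,
      (n : ℕ∞) < HorizontalLinkage.depth R] := by
  have hpow : ∀ a ∈ maximalIdeal R, ∃ s : ℕ, ∀ x : FGModuleCat.of R L, a ^ s • x = 0 :=
    fun a ha => IsFiniteLength.exists_pow_smul_eq_zero hL ha
  obtain ⟨e⟩ := hXY
  obtain ⟨e'⟩ := linkage_equiv_dualImage (iterSyzygy n (FGModuleCat.of R L))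
  let f : X →ₗ[R] dualImage (cover (iterSyzygy n (FGModuleCat.of R L))) :=
    e'.toLinearMap ∘ₗ e.symm.toLinearMap ∘ₗ LinearMap.inl R X Y
  let g : dualImage (cover (iterSyzygy n (FGModuleCat.of R L))) →ₗ[R] X :=
    LinearMap.fst R X Y ∘ₗ e.toLinearMap ∘ₗ e'.symm.toLinearMap
  have hgf : g ∘ₗ f = LinearMap.id := by
    ext x
    simp [f, g]
  have hg : Function.Surjective g := fun x => ⟨f x, LinearMap.congr_fun hgf x⟩
  have : Module.Finite R X := Module.Finite.of_surjective g hg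
  have hproj (hn : 1 ≤ n ∨ ¬ ExtVanishes R (R ⧸ maximalIdeal R) R 0) :
      ¬ HasProjectiveDimensionLT (ModuleCat.of R X) 1 := fun h =>
    not_projective_of_surjective hg hn ((IsProjective.iff_projective X).2
      (projective_iff_hasProjectiveDimensionLT_one.2 h))
  have hext {rs : List R} (hrs : RingTheory.Sequence.IsRegular R rs)
      (hm : ∀ r ∈ rs, r ∈ maximalIdeal R) (q : ℕ) (hqn : q + 2 ≤ n) (hq : q + 2 ≤ rs.length)
      (h : HasProjectiveDimensionLT (ModuleCat.of R X) (q + 2)) :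
      HasProjectiveDimensionLT (ModuleCat.of R X) (q + 1) :=
    hasProjectiveDimensionLT_of_extVanishes h
      ((extVanishes_dualImage_iterSyzygy (extVanishes_dualCoker_iterSyzygy hpow hrs hm) q n hqn
        hq).of_retract_left f g hgf)
  tfae_have 1 → 3 := by
    intro h
    by_contra hdepth
    obtain ⟨m, hm⟩ := (projectiveDimension_ne_top_iff _).1 h.ne
    -- The depth enters as the least `t` with `Ext^t(k, R) ≠ 0`; vanishing in degrees up to `n`
    -- would already give a regular sequence of length `n + 1`.
    have hex : ∃ t, ¬ ExtVanishes R (R ⧸ maximalIdeal R) R t := by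
      by_contra! hall
      obtain ⟨rs, hlen, hrs, hreg⟩ := exists_isRegular_of_extVanishes (t := n + 1)
        fun i _ => hall i
      exact hdepth (lt_depth_iff.2 ⟨rs, hreg, hrs, by omega⟩)
    classical
    obtain ⟨t, ht, hlt⟩ : ∃ t, ¬ ExtVanishes R (R ⧸ maximalIdeal R) R t ∧
        ∀ i < t, ExtVanishes R (R ⧸ maximalIdeal R) R i :=
      ⟨Nat.find hex, Nat.find_spec hex, fun i hi => not_not.1 (Nat.find_min hex hi)⟩
    obtain ⟨rs, hlen, hrs, hreg⟩ := exists_isRegular_of_extVanishes hlt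
    have htn : t ≤ n := by
      by_contra! hn
      exact hdepth (lt_depth_iff.2 ⟨rs, hreg, hrs, by omega⟩)
    obtain ⟨p, -, hp, hp'⟩ := exists_hasProjectiveDimensionLT_succ hm
    obtain _ | q := p
    · refine hproj ?_ hp
      rcases Nat.eq_zero_or_pos n with rfl | hn
      · obtain rfl := Nat.le_zero.1 htn
        exact Or.inr ht
      · exact Or.inl hn
    · obtain ⟨hqt, hX⟩ := not_extVanishes_of_projectiveDimension hlt ht q X hp hp'
      -- If `pd X = t`, then `Hom(k, X) ≠ 0`. But `X` embeds in the free cover of the transpose, and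
      -- `Hom(k, R) = 0` since `t ≥ 1`.
      have hne : q + 1 ≠ t := by
        rintro rfl
        rw [Nat.sub_self, extVanishes_zero_iff] at hX
        have h0 := extVanishes_zero_iff.1 ((hlt 0 (by omega)).pi
          (Fin (coverRank (transpose (iterSyzygy n (FGModuleCat.of R L))))))
        let c : X →ₗ[R] (Fin (coverRank (transpose (iterSyzygy n (FGModuleCat.of R L)))) → R) :=
          (LinearMap.ker (cover (transpose _))).subtype ∘ₗ e.symm.toLinearMap ∘ₗ
            LinearMap.inl R X Y
        have hc : Function.Injective c := (Submodule.injective_subtype _).comp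
          (e.symm.injective.comp LinearMap.inl_injective)
        exact hX (subsingleton_of_forall_eq 0 fun φ => LinearMap.ext fun x => hc
          ((LinearMap.congr_fun (Subsingleton.elim (c ∘ₗ φ) 0) x).trans (map_zero c).symm))
      exact hp' (hext hreg hrs q (by omega) (by omega) hp)
  tfae_have 3 → 2 := by
    intro h
    obtain ⟨rs, hreg, hrs, hlen⟩ := lt_depth_iff.1 h
    have hV : ∀ i ≤ n, ExtVanishes R (FGModuleCat.of R L) R i := fun i hi =>
      extVanishes_of_pow_smul_eq_zero hpow hreg hrs i (by omega)
    have hN := hasProjectiveDimensionLT_dualImage_iterSyzygy hV n le_rfl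
    have hr : Retract (ModuleCat.of R X)
        (ModuleCat.of R (dualImage (cover (iterSyzygy n (FGModuleCat.of R L))))) :=
      { i := ModuleCat.ofHom f
        r := ModuleCat.ofHom g
        retract := by rw [← ModuleCat.ofHom_comp, hgf]; rfl }
    refine le_antisymm ((projectiveDimension_le_iff _ n).2 (hr.hasProjectiveDimensionLT (n + 1)))
      ((projectiveDimension_ge_iff _ n).2 fun hlt => ?_)
    -- Here `p` is the exact projective dimension, assumed less than `n`; in particular `n ≥ 1`,
    -- which rules out `p = 0`.
    obtain ⟨p, hpn, hp, hp'⟩ := exists_hasProjectiveDimensionLT_succ hlt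
    obtain _ | q := p
    · exact hproj (Or.inl hpn) hp
    · exact hp' (hext hreg hrs q (by omega) (by omega) hp)
  tfae_have 2 → 1 := by
    intro h
    rw [h]
    exact WithBot.coe_lt_coe.2 (ENat.natCast_lt_top n)
  tfae_finish
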